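/- Let $H$ be a separable complex Hilbert space with inner product $(\cdot,\cdot)$, linear in the first variable. Let $(p_n)_{n\ge 1}$ be an increasing sequence of orthogonal projections on $H$ with $\bigvee_n p_n=I$, let $H_n=p_nH$ and $\mathcal X=\bigcup_n H_n$. Let $\mathcal C_2(H_n)$ be the Hilbert–Schmidt operators on $H_n$, regarded as the Hilbert–Schmidt operators $a$ on $H$ with $p_nap_n=a$, and let $\mathcal A=\bigcup_n\mathcal C_2(H_n)$, a $*$-algebra. Let $\Phi$ be a linear map from $\mathcal A$ to the space $\mathcal L(\mathcal X)$ of all linear maps $\mathcal X\to\mathcal X$ such that (a) $\Phi$ is completely positive: $\sum_{k,l=1}^n(\Phi(a_k^*a_l)\xi_l,\xi_k)\ge 0$ for all $n\in\mathbb N$, $a_1,\dots,a_n\in\mathcal A$ and $\xi_1,\dots,\xi_n\in\mathcal X$; (b) $\Phi(p_nap_m)=p_n\Phi(a)p_m$ for all $n,m\in\mathbb N$ and $a\in\mathcal A$; (c) for every $n$ the restriction of $\Phi$ to $\mathcal C_2(H_n)$ is bounded with respect to the operator norm: there is a constant $C_n$ with $\|\Phi(a)\xi\|\le C_n\|a\|_{\mathrm{op}}\|\xi\|$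 for all $a\in\mathcal C_2(H_n)$ and $\xi\in\mathcal X$. Then: (i) There is a sequence $(V_i)_{i=1}^\infty$ of closable linear maps from $\mathcal X$ into $H$ such that $$(\Phi(a)\xi,\eta)=\sum_{i=1}^\infty(aV_i\xi,V_i\eta)\qquad\text{for all } a\in\mathcal A,\ \xi,\eta\in\mathcal X,$$ the series being absolutely convergent. (ii) If $\mathcal D\subseteq\mathcal B(H)$ is a unital C*-subalgebra which contains all the $p_n$, and $\Phi$ is $\mathcal D$-bimodular, that is, $\Phi(ras)\xi=r\Phi(a)s\xi$ for all $r,s\in\mathcal D$, $a\in\mathcal A$ and $\xi\in\mathcal X$ for which $ras\in\mathcal A$ and $s\xi\in\mathcal X$, then there is such a sequence $(V_i)$ as in (i) for which, in addition, the closure of every $V_i$ is affiliated with the commutant $\mathcal D'$. Here a closed densely defined operator $T$ on $H$ is affiliated with a von Neumann algebra $\mathcal M$ if $uT=Tu$, with equality of domains, for every unitary $u\in\mathcal M'$. -/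

import Mathlib

open scoped ComplexOrder

namespace UnboundedStinespring

variable {H : Type*} [NormedAddCommGroup H] [InnerProductSpace ℂ H] [CompleteSpace H]

/-! ### Hilbert-Schmidt operators -/

/-- A bounded operator `a` is Hilbert-Schmidt if `∑ ‖a eᵢ‖² < ∞` for some orthonormal basis
`(eᵢ)` of `H` (equivalently for every one, see `IsHilbertSchmidt.summable`). -/
def IsHilbertSchmidt (a : H →L[ℂ] H) : Prop :=
  ∃ (s : Set H) (b : HilbertBasis s ℂ H), Summable fun i => ‖a (b i)‖ ^ 2

theorem hasSum_norm_inner_sq {ι : Type*} (b : HilbertBasis ι ℂ H) (x : H) :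
    HasSum (fun i => ‖(inner ℂ (b i) x : ℂ)‖ ^ 2) (‖x‖ ^ 2) := by
  have h := (b.hasSum_inner_mul_inner x x).mapL Complex.reCLM
  convert h using 1
  · funext i
    have h1 : (inner ℂ x (b i) : ℂ) = (starRingEnd ℂ) (inner ℂ (b i) x) :=
      (inner_conj_symm _ _).symm
    rw [h1, ← Complex.normSq_eq_conj_mul_self]
    simp [Complex.normSq_eq_norm_sq]
    norm_cast
  · simp only [Complex.reCLM_apply]
    rw [inner_self_eq_norm_sq_to_K]
    norm_cast

theorem tsum_enorm_inner_sq {ι : Type*} (b : HilbertBasis ι ℂ H) (x : H) :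
    ∑' i, ENNReal.ofReal (‖(inner ℂ (b i) x : ℂ)‖ ^ 2) = ENNReal.ofReal (‖x‖ ^ 2) := by
  rw [← (hasSum_norm_inner_sq b x).tsum_eq]
  exact (ENNReal.ofReal_tsum_of_nonneg (fun _ => by positivity)
    (hasSum_norm_inner_sq b x).summable).symm

theorem tsum_hilbertSchmidt_adjoint {ι κ : Type*} (b : HilbertBasis ι ℂ H)
    (c : HilbertBasis κ ℂ H) (a : H →L[ℂ] H) :
    ∑' i, ENNReal.ofReal (‖a (b i)‖ ^ 2) = ∑' j, ENNReal.ofReal (‖(star a) (c j)‖ ^ 2) := by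
  simp_rw [← tsum_enorm_inner_sq c (a _), ← tsum_enorm_inner_sq b (star a _)]
  rw [ENNReal.tsum_comm]
  congr 1; funext j; congr 1; funext i
  rw [ContinuousLinearMap.star_eq_adjoint, ContinuousLinearMap.adjoint_inner_right,
    norm_inner_symm]

theorem summable_iff_tsum_ne_top {ι : Type*} (f : ι → ℝ) (hf : ∀ i, 0 ≤ f i) :
    Summable f ↔ ∑' i, ENNReal.ofReal (f i) ≠ ⊤ := by
  refine ⟨fun h => h.tsum_ofReal_ne_top, fun h => ?_⟩
  have := ENNReal.summable_toReal h
  simpa [ENNReal.toReal_ofReal (hf _)] using this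

theorem IsHilbertSchmidt.star_summable {a : H →L[ℂ] H} (h : IsHilbertSchmidt a) {ι : Type*}
    (b : HilbertBasis ι ℂ H) : Summable fun i => ‖(star a) (b i)‖ ^ 2 := by
  obtain ⟨s, c, hc⟩ := h
  rw [summable_iff_tsum_ne_top _ (fun _ => by positivity)] at hc ⊢
  rwa [← tsum_hilbertSchmidt_adjoint c b a]

theorem IsHilbertSchmidt.star {a : H →L[ℂ] H} (h : IsHilbertSchmidt a) :
    IsHilbertSchmidt (star a) := by
  obtain ⟨s, c, hc⟩ := id h
  exact ⟨s, c, h.star_summable c⟩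

/-- The Hilbert-Schmidt condition does not depend on the orthonormal basis. -/
theorem IsHilbertSchmidt.summable {a : H →L[ℂ] H} (h : IsHilbertSchmidt a) {ι : Type*}
    (b : HilbertBasis ι ℂ H) : Summable fun i => ‖a (b i)‖ ^ 2 := by
  simpa using h.star.star_summable b

theorem IsHilbertSchmidt.zero : IsHilbertSchmidt (0 : H →L[ℂ] H) := by
  obtain ⟨s, b, -⟩ := exists_hilbertBasis ℂ H
  exact ⟨s, b, by simpa using summable_zero⟩

theorem IsHilbertSchmidt.smul {a : H →L[ℂ] H} (h : IsHilbertSchmidt a) (c : ℂ) :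
    IsHilbertSchmidt (c • a) := by
  obtain ⟨s, b, hb⟩ := h
  refine ⟨s, b, ?_⟩
  simpa [norm_smul, mul_pow] using hb.mul_left (‖c‖ ^ 2)

theorem IsHilbertSchmidt.add {a a' : H →L[ℂ] H} (h : IsHilbertSchmidt a)
    (h' : IsHilbertSchmidt a') : IsHilbertSchmidt (a + a') := by
  obtain ⟨s, b, hb⟩ := h
  refine ⟨s, b, Summable.of_nonneg_of_le (fun _ => by positivity) (fun i => ?_)
    ((hb.add (h'.summable b)).mul_left 2)⟩
  have h1 := norm_add_le (a (b i)) (a' (b i))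
  have h2 : ‖(a + a') (b i)‖ ^ 2 ≤ (‖a (b i)‖ + ‖a' (b i)‖) ^ 2 := by
    gcongr
    simpa using h1
  nlinarith [sq_nonneg (‖a (b i)‖ - ‖a' (b i)‖)]

theorem IsHilbertSchmidt.mul_left {a : H →L[ℂ] H} (h : IsHilbertSchmidt a) (r : H →L[ℂ] H) :
    IsHilbertSchmidt (r * a) := by
  obtain ⟨s, b, hb⟩ := h
  refine ⟨s, b, Summable.of_nonneg_of_le (fun _ => by positivity) (fun i => ?_)
    (hb.mul_left (‖r‖ ^ 2))⟩
  rw [← mul_pow]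
  gcongr
  exact r.le_opNorm _

theorem IsHilbertSchmidt.mul_right {a : H →L[ℂ] H} (h : IsHilbertSchmidt a) (r : H →L[ℂ] H) :
    IsHilbertSchmidt (a * r) := by
  simpa using (h.star.mul_left (Star.star r)).star

/-! ### The exhausting sequence of projections and the local spaces -/

variable (H) in
/-- An increasing sequence `(pₙ)` of orthogonal projections on `H` (for the usual order of
self-adjoint operators) with `⋁ pₙ = I`, that is, the ranges `Hₙ = pₙ H` span a dense subspace. -/
structure ProjectionSequence where
  p : ℕ → H →L[ℂ] H
  isStarProjection : ∀ n, IsStarProjection (p n)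
  monotone : Monotone p
  dense : (⨆ n, (p n).range).topologicalClosure = ⊤

namespace ProjectionSequence

variable (P : ProjectionSequence H)

theorem mul_of_le {m n : ℕ} (h : m ≤ n) : P.p n * P.p m = P.p m :=
  ((P.isStarProjection m).le_iff_mul_eq_right (P.isStarProjection n)).mp (P.monotone h)

theorem mul_of_le' {m n : ℕ} (h : m ≤ n) : P.p m * P.p n = P.p m :=
  ((P.isStarProjection m).le_iff_mul_eq_left (P.isStarProjection n)).mp (P.monotone h)

theorem range_mono : Monotone fun n => (P.p n).range := by
  rintro m n h _ ⟨x, rfl⟩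
  exact ⟨P.p m x, congrArg (fun T : H →L[ℂ] H => T x) (P.mul_of_le h)⟩

/-- The subspace `X = ⋃ₙ Hₙ` of `H`. -/
def X : Submodule ℂ H := ⨆ n, (P.p n).range

theorem mem_X_iff_exists_range {x : H} : x ∈ P.X ↔ ∃ n, x ∈ (P.p n).range :=
  Submodule.mem_iSup_of_directed _ P.range_mono.directed_le

theorem mem_range_iff {n : ℕ} {x : H} : x ∈ (P.p n).range ↔ P.p n x = x := by
  refine ⟨?_, fun h => ⟨x, h⟩⟩
  rintro ⟨y, rfl⟩
  exact congrArg (fun T : H →L[ℂ] H => T y) (P.isStarProjection n).isIdempotentElem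

/-- `a` belongs to `C₂(Hₙ)`, the Hilbert-Schmidt operators on `Hₙ`, regarded as operators on `H`
which vanish on the orthogonal complement of `Hₙ`. -/
def MemC2 (n : ℕ) (a : H →L[ℂ] H) : Prop :=
  IsHilbertSchmidt a ∧ P.p n * a * P.p n = a

variable {P} in
theorem MemC2.left {n : ℕ} {a : H →L[ℂ] H} (h : P.MemC2 n a) {m : ℕ} (hm : n ≤ m) :
    P.p m * a = a := by
  rw [← h.2, ← mul_assoc, ← mul_assoc, P.mul_of_le hm]

variable {P} in
theorem MemC2.right {n : ℕ} {a : H →L[ℂ] H} (h : P.MemC2 n a) {m : ℕ} (hm : n ≤ m) :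
    a * P.p m = a := by
  rw [← h.2, mul_assoc, P.mul_of_le' hm]

variable {P} in
theorem MemC2.mono {n m : ℕ} {a : H →L[ℂ] H} (h : P.MemC2 n a) (hm : n ≤ m) : P.MemC2 m a :=
  ⟨h.1, by rw [h.left hm, h.right hm]⟩

/-- The `*`-algebra `A = ⋃ₙ C₂(Hₙ)`. -/
def A : NonUnitalStarSubalgebra ℂ (H →L[ℂ] H) where
  carrier := {a | ∃ n, P.MemC2 n a}
  zero_mem' := ⟨0, IsHilbertSchmidt.zero, by simp⟩
  add_mem' := by
    rintro a b ⟨n, ha⟩ ⟨m, hb⟩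
    have ha' := ha.mono (le_max_left n m)
    have hb' := hb.mono (le_max_right n m)
    exact ⟨max n m, ha'.1.add hb'.1, by rw [mul_add, add_mul, ha'.2, hb'.2]⟩
  smul_mem' := by
    rintro c a ⟨n, ha⟩
    exact ⟨n, ha.1.smul c, by rw [mul_smul_comm, smul_mul_assoc, ha.2]⟩
  mul_mem' := by
    rintro a b ⟨n, ha⟩ ⟨m, hb⟩
    exact ⟨max n m, hb.1.mul_left a, by
      rw [← mul_assoc, ha.left (le_max_left n m), mul_assoc, hb.right (le_max_right n m)]⟩
  star_mem' := by
    rintro a ⟨n, ha⟩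
    refine ⟨n, ha.1.star, ?_⟩
    have h := congrArg star ha.2
    simpa [mul_assoc, (P.isStarProjection n).isSelfAdjoint.star_eq] using h

theorem mem_A_iff {a : H →L[ℂ] H} : a ∈ P.A ↔ ∃ n, P.MemC2 n a := Iff.rfl

theorem p_apply_mem_X (n : ℕ) (x : H) : P.p n x ∈ P.X :=
  P.mem_X_iff_exists_range.mpr ⟨n, x, rfl⟩

theorem p_mul_mul_p_mem_A {a : H →L[ℂ] H} (ha : a ∈ P.A) (n m : ℕ) :
    P.p n * a * P.p m ∈ P.A := by
  obtain ⟨k, hk⟩ := ha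
  refine ⟨max n m, (hk.1.mul_left _).mul_right _, ?_⟩
  rw [← mul_assoc, ← mul_assoc, P.mul_of_le (le_max_left n m), mul_assoc,
    P.mul_of_le' (le_max_right n m)]

/-- `pₙ` as a linear map on `X`. -/
noncomputable def pX (n : ℕ) : Module.End ℂ P.X :=
  ((P.p n : H →ₗ[ℂ] H).comp P.X.subtype).codRestrict P.X fun x => P.p_apply_mem_X n x

/-- `pₙ a pₘ` as an element of `A`, for `a ∈ A`. -/
def cut (n m : ℕ) (a : P.A) : P.A :=
  ⟨P.p n * (a : H →L[ℂ] H) * P.p m, P.p_mul_mul_p_mem_A a.2 n m⟩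

/-! ### Properties of linear maps `Φ : A → L(X)`

The inner product of `x` and `y`, linear in `x`, is Mathlib's `inner ℂ y x`. -/

/-- Complete positivity: `∑_{k,l} (Φ(aₖ* aₗ) ξₗ, ξₖ) ≥ 0`. -/
def IsCompletelyPositive (Φ : P.A →ₗ[ℂ] Module.End ℂ P.X) : Prop :=
  ∀ (n : ℕ) (a : Fin n → P.A) (ξ : Fin n → P.X),
    0 ≤ ∑ k, ∑ l, inner ℂ (ξ k : H) (Φ (star (a k) * a l) (ξ l) : H)

/-- Compatibility with the projections: `Φ(pₙ a pₘ) = pₙ Φ(a) pₘ`. -/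
def IsCompatible (Φ : P.A →ₗ[ℂ] Module.End ℂ P.X) : Prop :=
  ∀ (n m : ℕ) (a : P.A), Φ (P.cut n m a) = P.pX n * Φ a * P.pX m

/-- For each `n`, the restriction of `Φ` to `C₂(Hₙ)` is bounded for the operator norms. -/
def IsLocallyBounded (Φ : P.A →ₗ[ℂ] Module.End ℂ P.X) : Prop :=
  ∀ n, ∃ C : ℝ, ∀ a : P.A, P.MemC2 n a → ∀ ξ : P.X,
    ‖(Φ a ξ : H)‖ ≤ C * ‖(a : H →L[ℂ] H)‖ * ‖(ξ : H)‖

/-- `D`-bimodularity: `Φ(r a s) = r Φ(a) s` for `r, s ∈ D` and `a ∈ A`. Elements of `D` need not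
map `X` into `X` or multiply `A` into `A`; the identity is required, and evaluated at `ξ ∈ X`,
exactly when it makes sense, that is, when `r a s ∈ A` and `s ξ ∈ X`. If `D X ⊆ X`, this is always
the case. -/
def IsBimodular (D : StarSubalgebra ℂ (H →L[ℂ] H)) (Φ : P.A →ₗ[ℂ] Module.End ℂ P.X) : Prop :=
  ∀ r ∈ D, ∀ s ∈ D, ∀ a b : P.A, (b : H →L[ℂ] H) = r * a * s →
    ∀ ξ η : P.X, (η : H) = s ξ → (Φ b ξ : H) = r (Φ a η)

end ProjectionSequence

/-! ### Affiliated operators -/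

/-- The commutant `D'` of a unital `*`-algebra `D` of operators, as a von Neumann algebra. -/
noncomputable def commutant (D : StarSubalgebra ℂ (H →L[ℂ] H)) : VonNeumannAlgebra H where
  toStarSubalgebra := StarSubalgebra.centralizer ℂ (D : Set (H →L[ℂ] H))
  centralizer_centralizer' := by
    have h : (star (D : Set (H →L[ℂ] H))) = D := by
      ext x; simp
    simp [StarSubalgebra.coe_centralizer, h]

theorem mem_commutant_iff {D : StarSubalgebra ℂ (H →L[ℂ] H)} {z : H →L[ℂ] H} :
    z ∈ commutant D ↔ ∀ g ∈ D, g * z = z * g := by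
  change z ∈ StarSubalgebra.centralizer ℂ (D : Set (H →L[ℂ] H)) ↔ _
  rw [StarSubalgebra.mem_centralizer_iff]
  exact ⟨fun h g hg => (h g hg).1, fun h g hg => ⟨h g hg, h _ (star_mem hg)⟩⟩

/-- A closed densely defined operator `T` on `H` is affiliated with the von Neumann algebra `M`
if `u T = T u` (with equality of domains) for every unitary `u` in `M'`. As the unitaries of `M'`
form a group, this amounts to `u (dom T) ⊆ dom T` and `T u x = u T x` for `x ∈ dom T`. -/
def IsAffiliated (T : H →ₗ.[ℂ] H) (M : VonNeumannAlgebra H) : Prop :=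
  T.IsClosed ∧ Dense (T.domain : Set H) ∧
    ∀ u ∈ M.commutant, u ∈ unitary (H →L[ℂ] H) →
      ∀ x : T.domain, ∃ y : T.domain, (y : H) = u x ∧ T y = u (T x)

/-- A linear map from a subspace `Y` of `H` to `H`, as an operator on `H` with domain `Y`. -/
def toPMap {Y : Submodule ℂ H} (V : Y →ₗ[ℂ] H) : H →ₗ.[ℂ] H := ⟨Y, V⟩

end UnboundedStinespring

/-!
If `e ∈ X` is a unit vector, then `|x⟩⟨y| = (|e⟩⟨x|)* |e⟩⟨y|`. Complete positivity of `Φ` therefore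
makes the kernel `((x, ξ), (y, η)) ↦ (Φ(|x⟩⟨y|) η, ξ)` on `X × X` positive semidefinite, and its
feature map `k` is a Stinespring dilation of `Φ`. By local boundedness, each coordinate of `k x ξ`
with respect to an orthonormal basis of the feature space is bounded and antilinear in `x`, so by
the Riesz representation theorem it equals `(V_j ξ, x)` for a linear map `V_j`. Parseval's identity
is then the desired representation of `Φ` on rank one operators. Testing it on `p_n q p_n` with
finite rank projections `q` gives `∑ ‖V_j ξ‖² < ∞`, and the representation extends to all of `A` by
approximation in norm.

The maps `V_j` commute with every `d` for which `Φ(a d) = Φ(a) d` and `d*` preserves `X`. For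
`d = p_n` this makes `V_j` closable, since it is bounded on each `H_n`. For `d = p_n r p_n` with
`r ∈ D` it shows, letting `n → ∞`, that the closure of the graph of `V_j` is invariant under
`r ⊕ r`. The projection of `H ⊕ H` onto it therefore commutes with `r ⊕ r` for all `r ∈ D`, hence
for all `r ∈ D''`, which is affiliation with `D'`. If `H` is separable, then only countably many of
the `V_j` are nonzero.
-/

namespace UnboundedStinespring

open ContinuousLinearMap Filter InnerProductSpace Topology

universe u

section Affiliation

/-! ### Subspaces invariant under the bicommutant -/

theorem commute_starProjection_of_mem_invtSubmodule {𝕜 K : Type*} [RCLike 𝕜]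
    [NormedAddCommGroup K] [InnerProductSpace 𝕜 K] [CompleteSpace K] {G : Submodule 𝕜 K}
    [G.HasOrthogonalProjection] {T : K →L[𝕜] K} (hT : G ∈ Module.End.invtSubmodule T)
    (hT' : G ∈ Module.End.invtSubmodule (adjoint T)) : Commute G.starProjection T := by
  rw [isStarProjection_starProjection.isIdempotentElem.commute_iff]
  exact ⟨by simpa using hT, by simpa using orthogonal_mem_invtSubmodule hT'⟩

theorem commute_prodMap_iff {R E : Type*} [Semiring R] [AddCommMonoid E]
    [Module R E] [TopologicalSpace E] {d : E →L[R] E} {T : E × E →L[R] E × E} :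
    Commute (d.prodMap d) T ↔
      (Commute d (.fst R E E ∘L T ∘L .inl R E E) ∧ Commute d (.snd R E E ∘L T ∘L .inl R E E)) ∧
        Commute d (.fst R E E ∘L T ∘L .inr R E E) ∧ Commute d (.snd R E E ∘L T ∘L .inr R E E) := by
  have hsplit (z : E × E) : T z = T (z.1, 0) + T (0, z.2) := by simp [← map_add]
  simp only [Commute, SemiconjBy, ContinuousLinearMap.ext_iff, mul_apply_eq_comp, coe_prodMap',
    Prod.map_fst, Prod.map_snd, comp_apply, inl_apply, inr_apply, coe_fst', coe_snd', Prod.ext_iff]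
  constructor
  · intro h
    have hinl (x : E) := h (x, 0)
    have hinr (x : E) := h (0, x)
    simp only [Prod.map_apply, map_zero, forall_and] at hinl hinr
    exact ⟨hinl, hinr⟩
  · rintro ⟨⟨h₁₁, h₂₁⟩, h₁₂, h₂₂⟩ z
    simp [hsplit z, hsplit (Prod.map d d z), h₁₁, h₁₂, h₂₁, h₂₂]

variable {H : Type u} [NormedAddCommGroup H] [InnerProductSpace ℂ H]

/-- The operator `V` with domain `Y` commutes with `d`, wherever both `V d` and `d V` make sense. -/
def CommutesWith {Y : Submodule ℂ H} (V : Y →ₗ[ℂ] H) (d : H →L[ℂ] H) : Prop :=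
  ∀ ξ η : Y, (η : H) = d ξ → V η = d (V ξ)

theorem CommutesWith.prodMap_mem_closure_graph {Y : Submodule ℂ H} {V : Y →ₗ[ℂ] H}
    {d : H →L[ℂ] H} (h : CommutesWith V d) (hd : ∀ ξ ∈ Y, d ξ ∈ Y) {z : H × H}
    (hz : z ∈ (toPMap V).graph.topologicalClosure) :
    d.prodMap d z ∈ (toPMap V).graph.topologicalClosure := by
  refine map_mem_closure (d.prodMap d).continuous hz fun w hw => ?_
  obtain ⟨ξ, hξ, hVξ⟩ := (LinearPMap.mem_graph_iff _).mp hw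
  refine (LinearPMap.mem_graph_iff _).mpr ⟨⟨d ξ, hd ξ ξ.2⟩, ?_, ?_⟩
  · exact congrArg d hξ
  · exact (h ξ _ rfl).trans (congrArg d hVξ)

variable [CompleteSpace H]

/-- The operator `d ⊕ d` on the Hilbert space direct sum `H ⊕ H`, which is `WithLp 2 (H × H)`
because `H × H` itself carries the sup norm. -/
noncomputable def directSumSelf (d : H →L[ℂ] H) : WithLp 2 (H × H) →L[ℂ] WithLp 2 (H × H) :=
  (WithLp.prodContinuousLinearEquiv 2 ℂ H H).symm.conjContinuousAlgEquiv (d.prodMap d)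

theorem adjoint_directSumSelf (d : H →L[ℂ] H) :
    adjoint (directSumSelf d) = directSumSelf (star d) := by
  refine ((eq_adjoint_iff _ _).mpr fun z w => ?_).symm
  simp [directSumSelf, WithLp.prod_inner_apply, star_eq_adjoint, adjoint_inner_left]

theorem commute_directSumSelf_of_mem_bicommutant {D : StarSubalgebra ℂ (H →L[ℂ] H)}
    {T : WithLp 2 (H × H) →L[ℂ] WithLp 2 (H × H)} (hT : ∀ d ∈ D, Commute (directSumSelf d) T)
    {u : H →L[ℂ] H} (hu : u ∈ (commutant D).commutant) : Commute (directSumSelf u) T := by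
  set e := WithLp.prodContinuousLinearEquiv 2 ℂ H H
  have hconj (d : H →L[ℂ] H) : Commute (directSumSelf d) T ↔
      Commute (d.prodMap d) (e.conjContinuousAlgEquiv T) :=
    (commute_map_iff (f := e.conjContinuousAlgEquiv) e.conjContinuousAlgEquiv.injective).symm
  have hmem {S : H →L[ℂ] H} (hS : ∀ d ∈ D, Commute d S) : Commute u S :=
    (VonNeumannAlgebra.mem_commutant_iff.mp hu S (mem_commutant_iff.mpr hS)).symm
  simp only [hconj, commute_prodMap_iff, forall_and] at hT ⊢
  exact ⟨⟨hmem hT.1.1, hmem hT.1.2⟩, hmem hT.2.1, hmem hT.2.2⟩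

theorem prodMap_mem_of_mem_bicommutant {D : StarSubalgebra ℂ (H →L[ℂ] H)}
    {Γ : Submodule ℂ (H × H)} (hcl : IsClosed (Γ : Set (H × H)))
    (hΓ : ∀ d ∈ D, ∀ z ∈ Γ, d.prodMap d z ∈ Γ) {u : H →L[ℂ] H} (hu : u ∈ (commutant D).commutant)
    {z : H × H} (hz : z ∈ Γ) : u.prodMap u z ∈ Γ := by
  set e := WithLp.prodContinuousLinearEquiv 2 ℂ H H
  set G := Γ.comap (e : WithLp 2 (H × H) →ₗ[ℂ] H × H)
  have : CompleteSpace G := (hcl.preimage e.continuous).completeSpace_coe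
  have hinv (d : H →L[ℂ] H) (hd : d ∈ D) : G ∈ Module.End.invtSubmodule (directSumSelf d) :=
    fun w hw => hΓ d hd (e w) hw
  have hcomm : Commute (directSumSelf u) G.starProjection :=
    commute_directSumSelf_of_mem_bicommutant (fun d hd =>
      (commute_starProjection_of_mem_invtSubmodule (hinv d hd)
        (by simpa only [adjoint_directSumSelf] using hinv _ (star_mem hd))).symm) hu
  have hfix : G.starProjection (directSumSelf u (e.symm z)) = directSumSelf u (e.symm z) := by
    rw [← mul_apply_eq_comp, ← hcomm.eq, mul_apply_eq_comp,
      G.starProjection_eq_self_iff.mpr (by simpa [G] using hz)]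
  exact G.starProjection_eq_self_iff.mp hfix

/-! ### Closability and affiliation -/

theorem IsAffiliated.closure_of_invariant {D : StarSubalgebra ℂ (H →L[ℂ] H)} {T : H →ₗ.[ℂ] H}
    (hT : T.IsClosable) (hdense : Dense (T.domain : Set H))
    (hinv : ∀ d ∈ D, ∀ z ∈ T.graph.topologicalClosure,
      d.prodMap d z ∈ T.graph.topologicalClosure) :
    IsAffiliated T.closure (commutant D) := by
  refine ⟨hT.closure_isClosed, hdense.mono T.le_closure.1, fun u hu _ x => ?_⟩
  have hux : u.prodMap u (x, T.closure x) ∈ T.graph.topologicalClosure :=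
    prodMap_mem_of_mem_bicommutant (Submodule.isClosed_topologicalClosure _) hinv hu
      (hT.graph_closure_eq_closure_graph ▸ T.closure.mem_graph x)
  rw [hT.graph_closure_eq_closure_graph] at hux
  exact (LinearPMap.mem_graph_iff _).mp hux

namespace ProjectionSequence

variable (P : ProjectionSequence H)

theorem exists_p_apply_eq (x : P.X) : ∃ n, P.p n x = x :=
  (P.mem_X_iff_exists_range.mp x.2).imp fun _ => P.mem_range_iff.mp

theorem p_apply_p_apply (n : ℕ) (x : H) : P.p n (P.p n x) = P.p n x :=
  P.mem_range_iff.mp ⟨x, rfl⟩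

theorem star_p (n : ℕ) : star (P.p n) = P.p n :=
  (P.isStarProjection n).isSelfAdjoint.star_eq

theorem norm_p_apply_le (n : ℕ) (x : H) : ‖P.p n x‖ ≤ ‖x‖ :=
  ((P.p n).le_of_opNorm_le (P.isStarProjection n).norm_le x).trans_eq (one_mul _)

theorem dense_X : Dense (P.X : Set H) :=
  Submodule.dense_iff_topologicalClosure_eq_top.mpr P.dense

theorem tendsto_p_apply (x : H) : Tendsto (fun n => P.p n x) atTop (𝓝 x) := by
  choose _ hp using fun n => isStarProjection_iff_eq_starProjection_range.mp (P.isStarProjection n)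
  have h := Submodule.starProjection_tendsto_self _ P.range_mono x P.dense.ge
  exact h.congr fun n => (congrArg (fun T : H →L[ℂ] H => T x) (hp n)).symm

theorem tendsto_compression_apply (d : H →L[ℂ] H) (x : H) :
    Tendsto (fun n => (P.p n * d * P.p n) x) atTop (𝓝 (d x)) := by
  have hd : Tendsto (fun n => d (P.p n x) - d x) atTop (𝓝 0) := by
    simpa using ((d.continuous.tendsto x).comp (P.tendsto_p_apply x)).sub_const (d x)
  have hpd : Tendsto (fun n => P.p n (d (P.p n x) - d x)) atTop (𝓝 0) :=
    squeeze_zero_norm (fun n => P.norm_p_apply_le n _) (by simpa using hd.norm)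
  simpa using hpd.add (P.tendsto_p_apply (d x))

theorem compression_apply_mem_X (n : ℕ) (d : H →L[ℂ] H) (x : H) :
    (P.p n * d * P.p n) x ∈ P.X :=
  P.p_apply_mem_X n _

variable {P} {V : P.X →ₗ[ℂ] H}

theorem isClosable_toPMap (hV : ∀ n, CommutesWith V (P.p n))
    (hbdd : ∀ n, ∃ C : ℝ, ∀ ξ : P.X, P.p n ξ = ξ → ‖V ξ‖ ≤ C * ‖(ξ : H)‖) :
    (toPMap V).IsClosable := by
  refine ⟨(toPMap V).graph.topologicalClosure.toLinearPMap,
    (Submodule.toLinearPMap_graph_eq _ fun z hz hz₁ => ?_).symm⟩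
  have hp (n : ℕ) : P.p n z.2 = 0 := by
    obtain ⟨C, hC⟩ := hbdd n
    have hclosed : IsClosed {w : H × H | ‖P.p n w.2‖ ≤ C * ‖P.p n w.1‖} :=
      isClosed_le (by fun_prop) (by fun_prop)
    have hgraph : ((toPMap V).graph : Set (H × H)) ⊆ {w | ‖P.p n w.2‖ ≤ C * ‖P.p n w.1‖} := by
      intro w hw
      obtain ⟨ξ, rfl, hξ⟩ := (LinearPMap.mem_graph_iff' _).mp hw
      have := hC (P.pX n ξ) (P.p_apply_p_apply n ξ)
      rwa [hV n ξ _ rfl] at this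
    simpa [hz₁] using closure_minimal hgraph hclosed hz
  exact tendsto_nhds_unique (P.tendsto_p_apply z.2) (by simp [hp])

theorem isAffiliated_closure_toPMap (hV : (toPMap V).IsClosable)
    {D : StarSubalgebra ℂ (H →L[ℂ] H)}
    (hD : ∀ n, ∀ d ∈ D, CommutesWith V (P.p n * d * P.p n)) :
    IsAffiliated (toPMap V).closure (commutant D) := by
  refine .closure_of_invariant hV P.dense_X fun d hd z hz => ?_
  refine (Submodule.isClosed_topologicalClosure (toPMap V).graph).mem_of_tendsto
    ((P.tendsto_compression_apply d z.1).prodMk_nhds (P.tendsto_compression_apply d z.2))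
    (.of_forall fun n => ?_)
  exact (hD n d hd).prodMap_mem_closure_graph (fun ξ _ => P.compression_apply_mem_X n d ξ) hz

end ProjectionSequence

end Affiliation

/-! ### Finite rank operators -/

variable {H : Type u} [NormedAddCommGroup H] [InnerProductSpace ℂ H]

/-- The orthogonal projection onto the span of finitely many elements of a Hilbert basis. -/
noncomputable def basisProj {ι : Type*} (b : HilbertBasis ι ℂ H) (F : Finset ι) : H →L[ℂ] H :=
  ∑ i ∈ F, rankOne ℂ (b i) (b i)

theorem basisProj_apply_basis {ι : Type*} [DecidableEq ι] (b : HilbertBasis ι ℂ H) (F : Finset ι)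
    (j : ι) : basisProj b F (b j) = if j ∈ F then b j else 0 := by
  simp [basisProj, orthonormal_iff_ite.mp b.orthonormal]

variable [CompleteSpace H]

theorem isHilbertSchmidt_rankOne (x y : H) : IsHilbertSchmidt (rankOne ℂ x y) := by
  obtain ⟨s, b, -⟩ := exists_hilbertBasis ℂ H
  refine ⟨s, b, ?_⟩
  simpa [norm_smul, mul_pow, norm_inner_symm y] using
    (hasSum_norm_inner_sq b y).summable.mul_right (‖x‖ ^ 2)

theorem IsHilbertSchmidt.norm_sq_le_tsum {ι : Type*} {T : H →L[ℂ] H} (hT : IsHilbertSchmidt T)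
    (b : HilbertBasis ι ℂ H) : ‖T‖ ^ 2 ≤ ∑' i, ‖T (b i)‖ ^ 2 := by
  have hbound (y : H) : ‖(Star.star T) y‖ ^ 2 ≤ (∑' i, ‖T (b i)‖ ^ 2) * ‖y‖ ^ 2 := by
    refine hasSum_le (fun i => ?_) (hasSum_norm_inner_sq b ((Star.star T) y))
      ((hT.summable b).hasSum.mul_right (‖y‖ ^ 2))
    rw [star_eq_adjoint, adjoint_inner_right, ← mul_pow]
    gcongr
    exact norm_inner_le_norm _ _
  refine (Real.le_sqrt (norm_nonneg T) (tsum_nonneg fun _ => sq_nonneg _)).mp ?_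
  rw [← norm_star]
  refine opNorm_le_bound _ (Real.sqrt_nonneg _) fun y => ?_
  simpa using Real.sqrt_le_sqrt (hbound y)

theorem isStarProjection_basisProj {ι : Type*} (b : HilbertBasis ι ℂ H) (F : Finset ι) :
    IsStarProjection (basisProj b F) := by
  classical
  constructor
  · rw [IsIdempotentElem]
    nth_rw 2 3 [basisProj]
    rw [Finset.mul_sum]
    refine Finset.sum_congr rfl fun i hi => ?_
    rw [mul_def, comp_rankOne, basisProj_apply_basis, if_pos hi]
  · simp [IsSelfAdjoint, basisProj, star_sum, star_eq_adjoint]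

theorem IsHilbertSchmidt.tendsto_mul_basisProj {ι : Type*} {a : H →L[ℂ] H}
    (ha : IsHilbertSchmidt a) (b : HilbertBasis ι ℂ H) :
    Tendsto (fun F => a * basisProj b F) atTop (𝓝 a) := by
  classical
  have htail (F : Finset ι) :
      ‖a * basisProj b F - a‖ ^ 2 ≤ ∑' i : {i // i ∉ F}, ‖a (b i)‖ ^ 2 := by
    have hHS : IsHilbertSchmidt (a * (basisProj b F - 1)) := ha.mul_right _
    refine (mul_sub_one a (basisProj b F) ▸ hHS.norm_sq_le_tsum b).trans_eq ?_
    refine .trans (tsum_congr fun i => ?_) (tsum_subtype {i | i ∉ F} fun i => ‖a (b i)‖ ^ 2).symm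
    by_cases hi : i ∈ F <;> simp [basisProj_apply_basis, hi]
  have hsq : Tendsto (fun F => ‖a * basisProj b F - a‖ ^ 2) atTop (𝓝 0) :=
    squeeze_zero (fun _ => sq_nonneg _) htail
      (tendsto_tsum_compl_atTop_zero fun i => ‖a (b i)‖ ^ 2)
  rw [tendsto_iff_norm_sub_tendsto_zero]
  simpa using hsq.sqrt

namespace ProjectionSequence

variable {P : ProjectionSequence H}

theorem MemC2.sub {n : ℕ} {a b : H →L[ℂ] H} (ha : P.MemC2 n a) (hb : P.MemC2 n b) :
    P.MemC2 n (a - b) :=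
  ⟨by simpa [sub_eq_add_neg] using ha.1.add (hb.1.smul (-1)), by rw [mul_sub, sub_mul, ha.2, hb.2]⟩

variable (P)

theorem memC2_compression (n : ℕ) {a : H →L[ℂ] H} (ha : IsHilbertSchmidt a) :
    P.MemC2 n (P.p n * a * P.p n) := by
  refine ⟨(ha.mul_left _).mul_right _, ?_⟩
  have hidem : P.p n * P.p n = P.p n := (P.isStarProjection n).isIdempotentElem
  simp only [mul_assoc, hidem]
  simp only [← mul_assoc, hidem]

theorem norm_compression_le (n : ℕ) (a : H →L[ℂ] H) : ‖P.p n * a * P.p n‖ ≤ ‖a‖ := by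
  have hp : ‖P.p n‖ ≤ 1 := (P.isStarProjection n).norm_le
  calc ‖P.p n * a * P.p n‖ ≤ ‖P.p n‖ * ‖a‖ * ‖P.p n‖ := norm_mul₃_le
    _ ≤ 1 * ‖a‖ * 1 := by gcongr
    _ = ‖a‖ := by ring

theorem p_mul_rankOne_mul_p (n : ℕ) (x y : H) :
    P.p n * rankOne ℂ x y * P.p n = rankOne ℂ (P.p n x) (P.p n y) := by
  rw [mul_def, mul_def, comp_rankOne, rankOne_comp, ← star_eq_adjoint, P.star_p]

theorem memC2_rankOne {n : ℕ} {x y : H} (hx : P.p n x = x) (hy : P.p n y = y) :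
    P.MemC2 n (rankOne ℂ x y) :=
  ⟨isHilbertSchmidt_rankOne x y, by rw [p_mul_rankOne_mul_p, hx, hy]⟩

theorem rankOne_mem_A (x y : P.X) : rankOne ℂ (x : H) (y : H) ∈ P.A := by
  obtain ⟨n, hn⟩ := P.exists_p_apply_eq x
  obtain ⟨m, hm⟩ := P.exists_p_apply_eq y
  refine ⟨max n m, P.memC2_rankOne (P.mem_range_iff.mp ?_) (P.mem_range_iff.mp ?_)⟩
  · exact P.range_mono (le_max_left n m) (P.mem_range_iff.mpr hn)
  · exact P.range_mono (le_max_right n m) (P.mem_range_iff.mpr hm)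

/-- The rank one operator `z ↦ ⟪y, z⟫ x`, for `x` and `y` in `X`, as an element of `A`. -/
noncomputable def rankOneA (x y : P.X) : P.A :=
  ⟨rankOne ℂ (x : H) (y : H), P.rankOne_mem_A x y⟩

@[simp]
theorem coe_rankOneA (x y : P.X) : (P.rankOneA x y : H →L[ℂ] H) = rankOne ℂ (x : H) (y : H) := rfl

theorem rankOneA_add_right (x y z : P.X) :
    P.rankOneA x (y + z) = P.rankOneA x y + P.rankOneA x z := by
  ext1; simp

theorem rankOneA_smul_right (c : ℂ) (x y : P.X) :
    P.rankOneA x (c • y) = (starRingEnd ℂ) c • P.rankOneA x y := by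
  ext1; simp

variable {ι : Type*} (n : ℕ) (a : H →L[ℂ] H) (b : HilbertBasis ι ℂ H) (F : Finset ι)

/-- The finite rank operator `pₙ a q pₙ` of `A`, where `q` is the projection onto the span of
finitely many basis vectors. -/
noncomputable def finiteRankA : P.A :=
  ∑ i ∈ F, P.rankOneA ⟨P.p n (a (b i)), P.p_apply_mem_X n _⟩ ⟨P.p n (b i), P.p_apply_mem_X n _⟩

theorem coe_finiteRankA :
    (P.finiteRankA n a b F : H →L[ℂ] H) = P.p n * (a * basisProj b F) * P.p n := by
  have ha (i : ι) : rankOne ℂ (a (b i)) (b i) = a * rankOne ℂ (b i) (b i) :=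
    (comp_rankOne _ _ _).symm
  simp only [finiteRankA, basisProj, AddSubmonoidClass.coe_finsetSum, coe_rankOneA,
    ← p_mul_rankOne_mul_p, ha, Finset.mul_sum, Finset.sum_mul]

theorem memC2_finiteRankA : P.MemC2 n (P.finiteRankA n a b F) := by
  have hq : IsHilbertSchmidt (basisProj b F) :=
    Finset.sum_induction _ IsHilbertSchmidt (fun _ _ => .add) .zero
      fun _ _ => isHilbertSchmidt_rankOne _ _
  rw [coe_finiteRankA]
  exact P.memC2_compression n (hq.mul_left a)

theorem norm_finiteRankA_le : ‖(P.finiteRankA n a b F : H →L[ℂ] H)‖ ≤ ‖a‖ := by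
  rw [coe_finiteRankA]
  exact (P.norm_compression_le n _).trans ((norm_mul_le _ _).trans
    (mul_le_of_le_one_right (norm_nonneg a) (isStarProjection_basisProj b F).norm_le))

variable {P n a} in
theorem MemC2.tendsto_finiteRankA (ha : P.MemC2 n a) :
    Tendsto (fun F => (P.finiteRankA n a b F : H →L[ℂ] H)) atTop (𝓝 a) := by
  have h := ((ha.1.tendsto_mul_basisProj b).const_mul (P.p n)).mul_const (P.p n)
  simpa only [coe_finiteRankA, ha.2] using h

end ProjectionSequence

/-! ### Feature maps of positive semidefinite kernels -/

theorem isHermitian_of_sum_nonneg {α : Type*} {K : Matrix α α ℂ}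
    (hK : ∀ (n : ℕ) (x : Fin n → α) (c : Fin n → ℂ),
      0 ≤ ∑ k, ∑ l, star (c k) * K (x k) (x l) * c l) : K.IsHermitian := by
  ext x y
  have hx := (Complex.nonneg_iff.mp (hK 1 ![x] ![1])).2
  have hy := (Complex.nonneg_iff.mp (hK 1 ![y] ![1])).2
  have hxy := (Complex.nonneg_iff.mp (hK 2 ![x, y] ![1, 1])).2
  have hxy' := (Complex.nonneg_iff.mp (hK 2 ![x, y] ![1, Complex.I])).2
  simp only [Fin.sum_univ_two, Finset.univ_unique, Finset.sum_singleton, Fin.default_eq_zero,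
    Fin.isValue, Matrix.cons_val_fin_one, Matrix.cons_val_zero, Matrix.cons_val_one, star_one,
    RCLike.star_def, map_one, one_mul, mul_one, Complex.conj_I, Complex.add_im, Complex.mul_im,
    Complex.mul_re, Complex.neg_im, Complex.I_im, Complex.I_re, neg_mul, mul_zero, zero_mul,
    add_zero, zero_add, zero_sub, neg_neg] at hx hy hxy hxy'
  apply Complex.ext <;>
    simp only [Matrix.conjTranspose_apply, RCLike.star_def, Complex.conj_re, Complex.conj_im] <;>
    linarith

theorem posSemidef_of_sum_nonneg {α : Type*} {K : Matrix α α ℂ}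
    (hK : ∀ (n : ℕ) (x : Fin n → α) (c : Fin n → ℂ),
      0 ≤ ∑ k, ∑ l, star (c k) * K (x k) (x l) * c l) : K.PosSemidef := by
  refine ⟨isHermitian_of_sum_nonneg hK, fun c => ?_⟩
  let e := c.support.equivFin.symm
  refine (hK _ (fun k => e k) (fun k => c (e k))).trans_eq ?_
  simp only [Finsupp.sum]
  rw [← Finset.sum_coe_sort c.support, ← Equiv.sum_comp e]
  refine Finset.sum_congr rfl fun k _ => ?_
  rw [← Finset.sum_coe_sort c.support, ← Equiv.sum_comp e]

/-- Moore's theorem, the functions `⟪k x, ·⟫` separating the points of the feature space `L`. -/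
theorem exists_feature_map_of_posSemidef {α : Type u} {K : Matrix α α ℂ} (hK : K.PosSemidef) :
    ∃ (L : Type u) (_ : NormedAddCommGroup L) (_ : InnerProductSpace ℂ L) (_ : CompleteSpace L)
      (k : α → L), (∀ x y, inner ℂ (k x) (k y) = K x y) ∧
        ∀ v w : L, (∀ x, inner ℂ (k x) v = inner ℂ (k x) w) → v = w := by
  let K' : Matrix α α (ℂ →L[ℂ] ℂ) := K.map fun z => z • ContinuousLinearMap.id ℂ ℂ
  have hK' : K'.PosSemidef := by
    have h := (RKHS.posSemidef_tfae (K := K')).out 0 2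
    refine h.mpr ⟨?_, fun c => ?_⟩
    · ext x y
      simp [K', star_eq_adjoint, adjoint_id, ← hK.isHermitian.apply x y]
    · refine (Complex.nonneg_iff.mp (hK.2 c)).1.trans_eq (congrArg Complex.re ?_)
      refine Finset.sum_congr rfl fun x _ => Finset.sum_congr rfl fun y _ => ?_
      simp only [K', ← hK.isHermitian.apply x y, Matrix.map_apply, smul_apply, id_apply,
        smul_eq_mul, RCLike.inner_apply, RCLike.star_def, map_mul]
      ring
  have : Fact K'.PosSemidef := ⟨hK'⟩
  refine ⟨RKHS.OfKernel K', inferInstance, inferInstance, inferInstance,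
    fun x => RKHS.kerFun (RKHS.OfKernel K') x 1, fun x y => ?_, fun v w h => ?_⟩
  · rw [← RKHS.kernel_inner, RKHS.OfKernel.kernel_ofKernel]
    simp [K', ← hK.isHermitian.apply x y]
  · refine RKHS.ext fun x => ?_
    simpa using h x

/-! ### The minimal dilation -/

theorem exists_linearMap_forall_inner_eq {𝕜 K Y : Type*} [RCLike 𝕜] [NormedAddCommGroup K]
    [InnerProductSpace 𝕜 K] [CompleteSpace K] [AddCommGroup Y] [Module 𝕜 Y] {S : Submodule 𝕜 K}
    (hS : Dense (S : Set K)) (B : S →ₗ⋆[𝕜] Y →ₗ[𝕜] 𝕜)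
    (hB : ∀ y, ∃ C : ℝ, ∀ x, ‖B x y‖ ≤ C * ‖x‖) :
    ∃ V : Y →ₗ[𝕜] K, ∀ (x : S) (y : Y), inner 𝕜 (x : K) (V y) = B x y := by
  have hriesz (y : Y) : ∃ v : K, ∀ x : S, inner 𝕜 (x : K) v = B x y := by
    obtain ⟨C, hC⟩ := hB y
    let ℓ : S →ₗ[𝕜] 𝕜 :=
      { toFun := fun x => (starRingEnd 𝕜) (B x y)
        map_add' := by simp
        map_smul' := by simp }
    obtain ⟨g, hg, -⟩ := exists_extension_norm_eq S
      (ℓ.mkContinuous C fun x => (RCLike.norm_conj _).trans_le (hC x))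
    refine ⟨(toDual 𝕜 K).symm g, fun x => ?_⟩
    rw [← inner_conj_symm, toDual_symm_apply, hg]
    simp [ℓ]
  choose v hv using hriesz
  have hunique {w w' : K} (h : ∀ x : S, inner 𝕜 (x : K) w = inner 𝕜 (x : K) w') : w = w' :=
    hS.eq_of_inner_right 𝕜 fun x hx => h ⟨x, hx⟩
  exact ⟨
    { toFun := v
      map_add' := fun y z => hunique fun x => by simp [inner_add_right, hv]
      map_smul' := fun c y => hunique fun x => by simp [inner_smul_right, hv] }, fun x y => hv y x⟩

namespace ProjectionSequence

variable {P : ProjectionSequence H} {Φ : P.A →ₗ[ℂ] Module.End ℂ P.X}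

/-- `Φ(a d) = Φ(a) d` for all `a ∈ A`, wherever both sides make sense. -/
def CommutesRight (Φ : P.A →ₗ[ℂ] Module.End ℂ P.X) (d : H →L[ℂ] H) : Prop :=
  ∀ a b : P.A, (b : H →L[ℂ] H) = a * d → ∀ ξ η : P.X, (η : H) = d ξ → Φ b ξ = Φ a η

theorem IsCompatible.commutesRight (h : P.IsCompatible Φ) (m : ℕ) : CommutesRight Φ (P.p m) := by
  intro a b hb ξ η hη
  obtain ⟨n, hn⟩ := a.2
  have hcut (l : ℕ) {c : P.A} (hc : (c : H →L[ℂ] H) = a * P.p l) : c = P.cut n l a :=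
    Subtype.ext (hc.trans (congrArg (· * P.p l) (hn.left le_rfl).symm))
  have ha : Φ a η = P.pX n (Φ a (P.pX n η)) := by
    conv_lhs => rw [hcut n (hn.right le_rfl).symm, h]
    rfl
  have hpΦ : P.pX n (Φ a η) = Φ a η := by
    rw [ha]
    exact Subtype.ext (P.p_apply_p_apply n _)
  rw [hcut m hb, h, ← hpΦ, show η = P.pX m ξ from Subtype.ext hη]
  rfl

theorem IsBimodular.commutesRight {D : StarSubalgebra ℂ (H →L[ℂ] H)} (h : P.IsBimodular D Φ)
    {d : H →L[ℂ] H} (hd : d ∈ D) : CommutesRight Φ d := fun a b hb ξ η hη =>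
  Subtype.ext (by simpa using h 1 (one_mem D) d hd a b (by simpa using hb) ξ η hη)

/-- The kernel `((x, ξ), (y, η)) ↦ (Φ(|x⟩⟨y|) η, ξ)` on `X × X`. -/
noncomputable def kernel (Φ : P.A →ₗ[ℂ] Module.End ℂ P.X) : Matrix (P.X × P.X) (P.X × P.X) ℂ :=
  .of fun z w => inner ℂ (z.2 : H) (Φ (P.rankOneA z.1 w.1) w.2)

theorem star_rankOneA_mul_rankOneA {e : P.X} (he : ‖e‖ = 1) (x y : P.X) :
    star (P.rankOneA e x) * P.rankOneA e y = P.rankOneA x y := by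
  ext1
  simp [star_eq_adjoint, mul_def, comp_rankOne, inner_self_eq_norm_sq_to_K,
    show ‖(e : H)‖ = 1 from he]

theorem IsCompletelyPositive.posSemidef_kernel (hpos : P.IsCompletelyPositive Φ) :
    (kernel Φ).PosSemidef := by
  refine posSemidef_of_sum_nonneg fun n z c => ?_
  rcases subsingleton_or_nontrivial P.X with hX | hX
  · have hzero (w : P.X × P.X) : (w.2 : H) = 0 := congrArg Subtype.val (Subsingleton.elim w.2 0)
    simp [kernel, hzero]
  · obtain ⟨e, he⟩ := exists_norm_eq P.X zero_le_one
    refine (hpos n (fun k => P.rankOneA e (z k).1) (fun k => c k • (z k).2)).trans_eq ?_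
    refine Finset.sum_congr rfl fun k _ => Finset.sum_congr rfl fun l _ => ?_
    rw [star_rankOneA_mul_rankOneA he]
    simp only [kernel, Matrix.of_apply, map_smul, Submodule.coe_smul, inner_smul_left,
      inner_smul_right, RCLike.star_def]
    ring

section Dilation

variable {L : Type*} [NormedAddCommGroup L] [InnerProductSpace ℂ L]

/-- A Stinespring dilation of `Φ`, `k x ξ` standing for the class of `⟨x| ⊗ ξ`, whose dilation
space `L` is minimal. -/
structure IsMinimalDilation (Φ : P.A →ₗ[ℂ] Module.End ℂ P.X) (k : P.X →ₗ⋆[ℂ] P.X →ₗ[ℂ] L) :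
    Prop where
  inner_apply_apply : ∀ x y ξ η,
    inner ℂ (k x η) (k y ξ) = inner ℂ (η : H) (Φ (P.rankOneA x y) ξ : H)
  ext_inner : ∀ v w, (∀ x ξ, inner ℂ (k x ξ) v = inner ℂ (k x ξ) w) → v = w

variable {k : P.X →ₗ⋆[ℂ] P.X →ₗ[ℂ] L}

theorem IsMinimalDilation.apply_eq_apply (hk : IsMinimalDilation Φ k) {d : H →L[ℂ] H}
    (hd : CommutesRight Φ d) {x x' ξ ξ' : P.X} (hx : (x' : H) = star d x) (hξ : (ξ' : H) = d ξ) :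
    k x' ξ = k x ξ' := by
  refine hk.ext_inner _ _ fun y η => ?_
  rw [hk.inner_apply_apply, hk.inner_apply_apply, hd (P.rankOneA y x) (P.rankOneA y x') ?_ ξ ξ' hξ]
  rw [coe_rankOneA, coe_rankOneA, mul_def, rankOne_comp, hx, star_eq_adjoint]

theorem IsMinimalDilation.norm_apply_sq_le (hk : IsMinimalDilation Φ k) {n : ℕ} {C : ℝ}
    (hC : ∀ a : P.A, P.MemC2 n a → ∀ ξ : P.X,
      ‖(Φ a ξ : H)‖ ≤ C * ‖(a : H →L[ℂ] H)‖ * ‖(ξ : H)‖) {x : P.X} (hx : P.p n x = x) (ξ : P.X) :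
    ‖k x ξ‖ ^ 2 ≤ |C| * (‖x‖ * ‖ξ‖) ^ 2 := by
  have hΦ := hC (P.rankOneA x x) (P.memC2_rankOne hx hx) ξ
  rw [coe_rankOneA, norm_rankOne] at hΦ
  calc ‖k x ξ‖ ^ 2 = ‖inner ℂ (ξ : H) (Φ (P.rankOneA x x) ξ : H)‖ := by
        rw [← hk.inner_apply_apply, inner_self_eq_norm_sq_to_K]; simp
    _ ≤ ‖(ξ : H)‖ * (C * (‖(x : H)‖ * ‖(x : H)‖) * ‖(ξ : H)‖) :=
        (norm_inner_le_norm _ _).trans (by gcongr)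
    _ = C * (‖x‖ * ‖ξ‖) ^ 2 := by simp only [Submodule.norm_coe]; ring
    _ ≤ |C| * (‖x‖ * ‖ξ‖) ^ 2 := by gcongr; exact le_abs_self C

theorem IsMinimalDilation.exists_norm_apply_le (hk : IsMinimalDilation Φ k)
    (hcompat : P.IsCompatible Φ) (hbdd : P.IsLocallyBounded Φ) (ξ : P.X) :
    ∃ C : ℝ, ∀ x, ‖k x ξ‖ ≤ C * ‖x‖ := by
  obtain ⟨n, hn⟩ := P.exists_p_apply_eq ξ
  obtain ⟨C, hC⟩ := hbdd n
  refine ⟨√|C| * ‖ξ‖, fun x => abs_le_of_sq_le_sq' ?_ (by positivity) |>.2⟩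
  have hpx : k (P.pX n x) ξ = k x ξ :=
    hk.apply_eq_apply (hcompat.commutesRight n) (by rw [star_p]; rfl) hn.symm
  have hle : ‖P.pX n x‖ ≤ ‖x‖ := P.norm_p_apply_le n x
  calc ‖k x ξ‖ ^ 2 ≤ |C| * (‖P.pX n x‖ * ‖ξ‖) ^ 2 :=
        hpx ▸ hk.norm_apply_sq_le hC (P.p_apply_p_apply n x) ξ
    _ ≤ |C| * (‖x‖ * ‖ξ‖) ^ 2 := by gcongr
    _ = (√|C| * ‖ξ‖ * ‖x‖) ^ 2 := by simp only [mul_pow, Real.sq_sqrt (abs_nonneg C)]; ring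

end Dilation

theorem IsCompletelyPositive.exists_isMinimalDilation (hpos : P.IsCompletelyPositive Φ) :
    ∃ (L : Type u) (_ : NormedAddCommGroup L) (_ : InnerProductSpace ℂ L) (_ : CompleteSpace L)
      (k : P.X →ₗ⋆[ℂ] P.X →ₗ[ℂ] L), IsMinimalDilation Φ k := by
  obtain ⟨L, _, _, _, k, hk, hext⟩ := exists_feature_map_of_posSemidef hpos.posSemidef_kernel
  refine ⟨L, _, _, inferInstance,
    LinearMap.mk₂'ₛₗ (starRingEnd ℂ) (RingHom.id ℂ) (fun x ξ => k (x, ξ)) (fun x y ξ => ?_)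
      (fun c x ξ => ?_) (fun x ξ η => ?_) (fun c x ξ => ?_),
    fun x y ξ η => hk (x, η) (y, ξ), fun v w h => hext v w fun z => h z.1 z.2⟩
  all_goals
    refine hext _ _ fun z => ?_
    simp [hk, kernel, rankOneA_add_right, rankOneA_smul_right]

end ProjectionSequence

/-! ### Kraus families -/

namespace ProjectionSequence

variable {P : ProjectionSequence H} {Φ : P.A →ₗ[ℂ] Module.End ℂ P.X}

/-- A family of operators which represents `Φ` on the rank one operators and whose members commute
with all `d` for which `Φ(a d) = Φ(a) d`. That `d*` preserves `X` makes `d` act on the dilation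
space of `Φ`. -/
structure IsKrausFamily {ι : Type*} (V : ι → P.X →ₗ[ℂ] H) (Φ : P.A →ₗ[ℂ] Module.End ℂ P.X) :
    Prop where
  commutesWith : ∀ d : H →L[ℂ] H, CommutesRight Φ d → (∀ x : P.X, star d x ∈ P.X) →
    ∀ j, CommutesWith (V j) d
  hasSum_rankOneA : ∀ x y ξ η : P.X,
    HasSum (fun j => inner ℂ (V j η) (x : H) * inner ℂ (y : H) (V j ξ))
      (inner ℂ (η : H) (Φ (P.rankOneA x y) ξ : H))

theorem IsMinimalDilation.exists_isKrausFamily {L : Type u} [NormedAddCommGroup L]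
    [InnerProductSpace ℂ L] [CompleteSpace L] {k : P.X →ₗ⋆[ℂ] P.X →ₗ[ℂ] L}
    (hk : IsMinimalDilation Φ k) (hcompat : P.IsCompatible Φ) (hbdd : P.IsLocallyBounded Φ) :
    ∃ (ι : Type u) (V : ι → P.X →ₗ[ℂ] H), IsKrausFamily V Φ := by
  obtain ⟨s, f, -⟩ := exists_hilbertBasis ℂ L
  have hcoord (j : s) (ξ : P.X) : ∃ C : ℝ, ∀ x, ‖inner ℂ (f j) (k x ξ)‖ ≤ C * ‖x‖ := by
    obtain ⟨C, hC⟩ := hk.exists_norm_apply_le hcompat hbdd ξ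
    refine ⟨C, fun x => (norm_inner_le_norm _ _).trans ?_⟩
    rw [f.orthonormal.1 j, one_mul]
    exact hC x
  choose V hV using fun j =>
    exists_linearMap_forall_inner_eq P.dense_X (k.compr₂ₛₗ (innerₛₗ ℂ (f j))) (hcoord j)
  replace hV (j : s) (x ξ : P.X) : inner ℂ (x : H) (V j ξ) = inner ℂ (f j) (k x ξ) := hV j x ξ
  refine ⟨s, V, fun d hd hX j ξ η hη => ?_, fun x y ξ η => ?_⟩
  · refine P.dense_X.eq_of_inner_right ℂ fun x hx => ?_
    have hk_eq := hk.apply_eq_apply hd (x := ⟨x, hx⟩) (x' := ⟨star d x, hX ⟨x, hx⟩⟩) rfl hη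
    rw [← adjoint_inner_left, ← star_eq_adjoint]
    exact (hV j ⟨x, hx⟩ η).trans (hk_eq ▸ (hV j ⟨star d x, _⟩ ξ).symm)
  · have hsum := f.hasSum_inner_mul_inner (k x η) (k y ξ)
    rw [hk.inner_apply_apply] at hsum
    refine hsum.congr_fun fun j => ?_
    rw [← inner_conj_symm (V j η), hV, hV, inner_conj_symm]

theorem IsCompletelyPositive.exists_isKrausFamily (hpos : P.IsCompletelyPositive Φ)
    (hcompat : P.IsCompatible Φ) (hbdd : P.IsLocallyBounded Φ) :
    ∃ (ι : Type u) (V : ι → P.X →ₗ[ℂ] H), IsKrausFamily V Φ := by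
  obtain ⟨L, _, _, _, k, hk⟩ := hpos.exists_isMinimalDilation
  exact hk.exists_isKrausFamily hcompat hbdd

theorem IsLocallyBounded.tendsto_apply {κ : Type*} {l : Filter κ} (hbdd : P.IsLocallyBounded Φ)
    {n : ℕ} {a : P.A} (ha : P.MemC2 n a) {a' : κ → P.A} (ha' : ∀ i, P.MemC2 n (a' i))
    (h : Tendsto (fun i => (a' i : H →L[ℂ] H)) l (𝓝 a)) (ξ : P.X) :
    Tendsto (fun i => (Φ (a' i) ξ : H)) l (𝓝 (Φ a ξ)) := by
  obtain ⟨C, hC⟩ := hbdd n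
  have hle (i : κ) : ‖(Φ (a' i) ξ - Φ a ξ : H)‖ ≤ C * ‖(a' i - a : H →L[ℂ] H)‖ * ‖(ξ : H)‖ := by
    simpa using hC (a' i - a) ((ha' i).sub ha) ξ
  refine tendsto_iff_norm_sub_tendsto_zero.mpr (squeeze_zero (fun _ => norm_nonneg _) hle ?_)
  simpa using ((tendsto_iff_norm_sub_tendsto_zero.mp h).const_mul C).mul_const ‖(ξ : H)‖

theorem inner_finiteRankA_one_apply {κ : Type*} {n : ℕ} {v : H} (hv : P.p n v = v)
    (b : HilbertBasis κ ℂ H) (F : Finset κ) :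
    inner ℂ v ((P.finiteRankA n 1 b F : H →L[ℂ] H) v) =
      ((∑ i ∈ F, ‖inner ℂ (b i) v‖ ^ 2 : ℝ) : ℂ) := by
  rw [coe_finiteRankA, one_mul, mul_apply_eq_comp, mul_apply_eq_comp, hv, ← adjoint_inner_left,
    ← star_eq_adjoint, star_p, hv]
  simp only [basisProj, sum_apply, rankOne_apply, inner_sum, inner_smul_right, Complex.ofReal_sum]
  refine Finset.sum_congr rfl fun i _ => ?_
  rw [← inner_conj_symm v, Complex.mul_conj, Complex.normSq_eq_norm_sq]

namespace IsKrausFamily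

variable {ι : Type*} {V : ι → P.X →ₗ[ℂ] H}

theorem commutesWith_p (hV : IsKrausFamily V Φ) (hcompat : P.IsCompatible Φ) (n : ℕ) (j : ι) :
    CommutesWith (V j) (P.p n) :=
  hV.commutesWith _ (hcompat.commutesRight n)
    (fun x => by rw [star_p]; exact P.p_apply_mem_X n x) j

theorem hasSum_finiteRankA (hV : IsKrausFamily V Φ) {κ : Type*} (n : ℕ) (a : H →L[ℂ] H)
    (b : HilbertBasis κ ℂ H) (F : Finset κ) (ξ η : P.X) :
    HasSum (fun j => inner ℂ (V j η) ((P.finiteRankA n a b F : H →L[ℂ] H) (V j ξ)))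
      (inner ℂ (η : H) (Φ (P.finiteRankA n a b F) ξ : H)) := by
  have h := hasSum_sum (s := F) fun i _ => hV.hasSum_rankOneA
    ⟨P.p n (a (b i)), P.p_apply_mem_X n _⟩ ⟨P.p n (b i), P.p_apply_mem_X n _⟩ ξ η
  simpa [finiteRankA, mul_comm] using h

theorem sum_norm_sq_le (hV : IsKrausFamily V Φ) (hcompat : P.IsCompatible Φ) {n : ℕ} {C : ℝ}
    (hC : ∀ a : P.A, P.MemC2 n a → ∀ ξ : P.X,
      ‖(Φ a ξ : H)‖ ≤ C * ‖(a : H →L[ℂ] H)‖ * ‖(ξ : H)‖) {ξ : P.X} (hξ : P.p n ξ = ξ)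
    (J : Finset ι) : ∑ j ∈ J, ‖V j ξ‖ ^ 2 ≤ |C| * ‖(ξ : H)‖ ^ 2 := by
  obtain ⟨s, b, -⟩ := exists_hilbertBasis ℂ H
  have hpV (j : ι) : P.p n (V j ξ) = V j ξ := (hV.commutesWith_p hcompat n j ξ ξ hξ.symm).symm
  -- Testing the representation on `pₙ q pₙ` bounds the coefficients of the `V j ξ` along `q`.
  refine hasSum_le_of_sum_le (hasSum_sum fun j _ => hasSum_norm_inner_sq b (V j ξ)) fun F => ?_
  have hsum := (hV.hasSum_finiteRankA n 1 b F ξ ξ).mapL Complex.reCLM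
  simp only [inner_finiteRankA_one_apply (hpV _), Complex.reCLM_apply, Complex.ofReal_re] at hsum
  have hone : ‖(P.finiteRankA n 1 b F : H →L[ℂ] H)‖ ≤ 1 :=
    (P.norm_finiteRankA_le n 1 b F).trans norm_id_le
  rw [Finset.sum_comm]
  calc ∑ j ∈ J, ∑ i ∈ F, ‖inner ℂ (b i) (V j ξ)‖ ^ 2
      ≤ (inner ℂ (ξ : H) (Φ (P.finiteRankA n 1 b F) ξ : H)).re :=
        sum_le_hasSum J (fun j _ => Finset.sum_nonneg fun i _ => sq_nonneg _) hsum
    _ ≤ ‖(ξ : H)‖ * ‖(Φ (P.finiteRankA n 1 b F) ξ : H)‖ :=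
        (Complex.re_le_norm _).trans (norm_inner_le_norm _ _)
    _ ≤ ‖(ξ : H)‖ * (|C| * 1 * ‖(ξ : H)‖) := by
        gcongr
        refine (hC _ (P.memC2_finiteRankA n 1 b F) ξ).trans ?_
        gcongr
        exact le_abs_self C
    _ = |C| * ‖(ξ : H)‖ ^ 2 := by ring

theorem summable_norm_sq (hV : IsKrausFamily V Φ) (hcompat : P.IsCompatible Φ)
    (hbdd : P.IsLocallyBounded Φ) (ξ : P.X) : Summable fun j => ‖V j ξ‖ ^ 2 := by
  obtain ⟨n, hn⟩ := P.exists_p_apply_eq ξ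
  obtain ⟨C, hC⟩ := hbdd n
  exact summable_of_sum_le (fun _ => sq_nonneg _) (hV.sum_norm_sq_le hcompat hC hn)

theorem exists_norm_le (hV : IsKrausFamily V Φ) (hcompat : P.IsCompatible Φ)
    (hbdd : P.IsLocallyBounded Φ) (n : ℕ) :
    ∃ C : ℝ, 0 ≤ C ∧ ∀ j (ξ : P.X), P.p n ξ = ξ → ‖V j ξ‖ ≤ C * ‖(ξ : H)‖ := by
  obtain ⟨C, hC⟩ := hbdd n
  refine ⟨√|C|, Real.sqrt_nonneg _, fun j ξ hξ => abs_le_of_sq_le_sq' ?_ (by positivity) |>.2⟩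
  simpa [mul_pow] using hV.sum_norm_sq_le hcompat hC hξ {j}

theorem hasSum (hV : IsKrausFamily V Φ) (hcompat : P.IsCompatible Φ)
    (hbdd : P.IsLocallyBounded Φ) (a : P.A) (ξ η : P.X) :
    HasSum (fun j => inner ℂ (V j η) ((a : H →L[ℂ] H) (V j ξ)))
      (inner ℂ (η : H) (Φ a ξ : H)) := by
  let φ (j : ι) : (H →L[ℂ] H) →L[ℂ] ℂ := innerSL ℂ (V j η) ∘L ContinuousLinearMap.apply ℂ H (V j ξ)
  have hφ (j : ι) : ‖φ j‖ ≤ ‖V j η‖ ^ 2 + ‖V j ξ‖ ^ 2 := by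
    refine opNorm_le_bound _ (by positivity) fun c => ?_
    calc ‖φ j c‖ ≤ ‖V j η‖ * (‖c‖ * ‖V j ξ‖) :=
          (norm_inner_le_norm _ _).trans (by gcongr; exact c.le_opNorm _)
      _ = ‖V j η‖ * ‖V j ξ‖ * ‖c‖ := by ring
      _ ≤ _ := by
        gcongr
        nlinarith [two_mul_le_add_sq ‖V j η‖ ‖V j ξ‖, sq_nonneg ‖V j η‖, sq_nonneg ‖V j ξ‖]
  have hsum : Summable φ := .of_norm_bounded
    ((hV.summable_norm_sq hcompat hbdd η).add (hV.summable_norm_sq hcompat hbdd ξ)) hφ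
  have happly (c : H →L[ℂ] H) : HasSum (fun j => φ j c) ((∑' j, φ j) c) :=
    hsum.hasSum.mapL (ContinuousLinearMap.apply ℂ ℂ c)
  obtain ⟨s, b, -⟩ := exists_hilbertBasis ℂ H
  obtain ⟨n, hn⟩ := a.2
  have hfinite (F : Finset s) : (∑' j, φ j) (P.finiteRankA n a b F : H →L[ℂ] H) =
      inner ℂ (η : H) (Φ (P.finiteRankA n a b F) ξ : H) :=
    (happly _).unique (hV.hasSum_finiteRankA n a b F ξ η)
  have hlim := ((∑' j, φ j).continuous.tendsto _).comp (hn.tendsto_finiteRankA b)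
  have hlim' := ((innerSL ℂ (η : H)).continuous.tendsto _).comp
    (hbdd.tendsto_apply hn (P.memC2_finiteRankA n a b) (hn.tendsto_finiteRankA b) ξ)
  have heq : (∑' j, φ j) (a : H →L[ℂ] H) = inner ℂ (η : H) (Φ a ξ : H) :=
    tendsto_nhds_unique hlim (hlim'.congr fun F => (hfinite F).symm)
  exact heq ▸ happly a

theorem isClosable (hV : IsKrausFamily V Φ) (hcompat : P.IsCompatible Φ)
    (hbdd : P.IsLocallyBounded Φ) (j : ι) : (toPMap (V j)).IsClosable :=
  isClosable_toPMap (hV.commutesWith_p hcompat · j) fun n =>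
    (hV.exists_norm_le hcompat hbdd n).imp fun _ hC => hC.2 j

theorem isAffiliated_closure (hV : IsKrausFamily V Φ) {D : StarSubalgebra ℂ (H →L[ℂ] H)}
    (hD : ∀ n, P.p n ∈ D) (hΦ : ∀ d ∈ D, CommutesRight Φ d) {j : ι}
    (hj : (toPMap (V j)).IsClosable) : IsAffiliated (toPMap (V j)).closure (commutant D) := by
  refine isAffiliated_closure_toPMap hj fun n d hd => hV.commutesWith _ ?_ (fun x => ?_) j
  · exact hΦ _ (mul_mem (mul_mem (hD n) hd) (hD n))
  · rw [star_mul, star_mul, star_p]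
    exact P.p_apply_mem_X n _

theorem continuous_apply_p (hV : IsKrausFamily V Φ) (hcompat : P.IsCompatible Φ)
    (hbdd : P.IsLocallyBounded Φ) (n : ℕ) (j : ι) :
    Continuous fun x : H => V j ⟨P.p n x, P.p_apply_mem_X n x⟩ := by
  obtain ⟨C, hC0, hC⟩ := hV.exists_norm_le hcompat hbdd n
  let q : H →ₗ[ℂ] P.X := (P.p n : H →ₗ[ℂ] H).codRestrict P.X (P.p_apply_mem_X n)
  refine AddMonoidHomClass.continuous_of_bound (V j ∘ₗ q) C fun x => ?_
  exact (hC j (q x) (P.p_apply_p_apply n x)).trans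
    (mul_le_mul_of_nonneg_left (P.norm_p_apply_le n x) hC0)

theorem countable_ne_zero [TopologicalSpace.SeparableSpace H] (hV : IsKrausFamily V Φ)
    (hcompat : P.IsCompatible Φ) (hbdd : P.IsLocallyBounded Φ) : {j | V j ≠ 0}.Countable := by
  obtain ⟨t, ht, htd⟩ := TopologicalSpace.exists_countable_dense H
  let q (n : ℕ) (y : H) : P.X := ⟨P.p n y, P.p_apply_mem_X n y⟩
  have hcount : (⋃ n, ⋃ y ∈ t, {j | V j (q n y) ≠ 0}).Countable := by
    refine Set.countable_iUnion fun n => ht.biUnion fun y _ => ?_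
    simpa [Function.support] using
      (hV.summable_norm_sq hcompat hbdd (q n y)).countable_support
  refine hcount.mono fun j => ?_
  contrapose!
  intro hj
  simp only [Set.mem_iUnion, Set.mem_ofPred_eq, not_exists, not_not] at hj
  refine not_not.mpr (LinearMap.ext fun ξ => ?_)
  obtain ⟨n, hn⟩ := P.exists_p_apply_eq ξ
  have hzero := (hV.continuous_apply_p hcompat hbdd n j).ext_on htd continuous_const (hj n)
  simpa [hn] using congrFun hzero ξ

theorem subtype_ne_zero (hV : IsKrausFamily V Φ) :
    IsKrausFamily (fun j : {j | V j ≠ 0} => V j) Φ where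
  commutesWith d hd hX j := hV.commutesWith d hd hX j
  hasSum_rankOneA x y ξ η := by
    have hsupp : Function.support (fun j => inner ℂ (V j η) (x : H) * inner ℂ (y : H) (V j ξ)) ⊆
        {j | V j ≠ 0} := fun j hj h0 => hj (by simp [h0])
    exact (hasSum_subtype_iff_of_support_subset hsupp).mpr (hV.hasSum_rankOneA x y ξ η)

theorem extend {κ : Type*} {e : ι → κ} (hV : IsKrausFamily V Φ) (he : e.Injective) :
    IsKrausFamily (Function.extend e V 0) Φ where
  commutesWith d hd hX i ξ η hη := by
    by_cases hi : ∃ j, e j = i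
    · obtain ⟨j, rfl⟩ := hi
      simpa only [he.extend_apply] using hV.commutesWith d hd hX j ξ η hη
    · simp [Function.extend_apply' _ _ _ hi]
  hasSum_rankOneA x y ξ η := by
    refine ((hasSum_extend_zero he).mpr (hV.hasSum_rankOneA x y ξ η)).congr_fun fun i => ?_
    rw [Function.apply_extend
      (fun T : P.X →ₗ[ℂ] H => inner ℂ (T η) (x : H) * inner ℂ (y : H) (T ξ))]
    congr
    ext
    simp

end IsKrausFamily

theorem IsCompletelyPositive.exists_isKrausFamily_nat [TopologicalSpace.SeparableSpace H]
    (hpos : P.IsCompletelyPositive Φ) (hcompat : P.IsCompatible Φ) (hbdd : P.IsLocallyBounded Φ) :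
    ∃ V : ℕ → P.X →ₗ[ℂ] H, IsKrausFamily V Φ := by
  obtain ⟨ι, V, hV⟩ := hpos.exists_isKrausFamily hcompat hbdd
  have : Countable {j | V j ≠ 0} := hV.countable_ne_zero hcompat hbdd
  obtain ⟨e, he⟩ := exists_injective_nat {j | V j ≠ 0}
  exact ⟨_, hV.subtype_ne_zero.extend he⟩

end ProjectionSequence

end UnboundedStinespring

theorem theorem2p2_general {H : Type*} [NormedAddCommGroup H] [InnerProductSpace ℂ H]
    [CompleteSpace H] [TopologicalSpace.SeparableSpace H]
    (P : UnboundedStinespring.ProjectionSequence H)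
    (Φ : P.A →ₗ[ℂ] Module.End ℂ P.X)
    (hpos : P.IsCompletelyPositive Φ)
    (hcompat : P.IsCompatible Φ)
    (hbdd : P.IsLocallyBounded Φ) :
    ∃ V : ℕ → P.X →ₗ[ℂ] H,
      (∀ i, (UnboundedStinespring.toPMap (V i)).IsClosable) ∧
      (∀ (a : P.A) (ξ η : P.X),
        HasSum (fun i => inner ℂ (V i η) ((a : H →L[ℂ] H) (V i ξ)))
          (inner ℂ (η : H) (Φ a ξ : H))) ∧
      ∀ D : StarSubalgebra ℂ (H →L[ℂ] H), (∀ n, P.p n ∈ D) →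
        (∀ d ∈ D, UnboundedStinespring.ProjectionSequence.CommutesRight Φ d) →
        ∀ i, UnboundedStinespring.IsAffiliated (UnboundedStinespring.toPMap (V i)).closure
          (UnboundedStinespring.commutant D) := by
  obtain ⟨V, hV⟩ := hpos.exists_isKrausFamily_nat hcompat hbdd
  have hcl := hV.isClosable hcompat hbdd
  exact ⟨V, hcl, hV.hasSum hcompat hbdd, fun D hD hΦ i => hV.isAffiliated_closure hD hΦ (hcl i)⟩

theorem theorem2p2 {H : Type*} [NormedAddCommGroup H] [InnerProductSpace ℂ H] [CompleteSpace H]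
    [TopologicalSpace.SeparableSpace H]
    (P : UnboundedStinespring.ProjectionSequence H)
    (Φ : P.A →ₗ[ℂ] Module.End ℂ P.X)
    (hpos : P.IsCompletelyPositive Φ)
    (hcompat : P.IsCompatible Φ)
    (hbdd : P.IsLocallyBounded Φ) :
    (∃ V : ℕ → P.X →ₗ[ℂ] H,
      (∀ i, (UnboundedStinespring.toPMap (V i)).IsClosable) ∧
      ∀ (a : P.A) (ξ η : P.X),
        HasSum (fun i => inner ℂ (V i η) ((a : H →L[ℂ] H) (V i ξ)))
          (inner ℂ (η : H) (Φ a ξ : H))) ∧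
    ∀ D : StarSubalgebra ℂ (H →L[ℂ] H), IsClosed (D : Set (H →L[ℂ] H)) →
      (∀ n, P.p n ∈ D) → P.IsBimodular D Φ →
      ∃ V : ℕ → P.X →ₗ[ℂ] H,
        (∀ i, (UnboundedStinespring.toPMap (V i)).IsClosable ∧
          UnboundedStinespring.IsAffiliated (UnboundedStinespring.toPMap (V i)).closure
            (UnboundedStinespring.commutant D)) ∧
        ∀ (a : P.A) (ξ η : P.X),
          HasSum (fun i => inner ℂ (V i η) ((a : H →L[ℂ] H) (V i ξ)))
            (inner ℂ (η : H) (Φ a ξ : H)) := by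
  obtain ⟨V, hcl, hsum, haff⟩ := theorem2p2_general P Φ hpos hcompat hbdd
  exact ⟨⟨V, hcl, hsum⟩, fun D _ hD hbim =>
    ⟨V, fun i => ⟨hcl i, haff D hD (fun d hd => hbim.commutesRight hd) i⟩, hsum⟩⟩
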